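/- **Model.** A plant uses $M$ raw materials and $K$ products; $\beta_{mk}\in\{0,1,2,\dots\}$ units of material $m$ are needed per item of product $k$, and $\alpha_k\ge 0$ is the assembly cost of product $k$. Time is slotted, $t=0,1,2,\dots$. The supply states $X(t)$ and the demand states $Y(t)$ take values in countable sets $\mathcal X$, $\mathcal Y$, with $\Pr[X(t)=x]=\pi(x)$ and $\Pr[Y(t)=y]=\pi(y)$ for all $t$ (for instance because they are stationary). In supply state $x$, material $m$ has unit price $x_m\ge 0$ and available amount $s_m\ge 0$; $c(\mathbf a,x)=\sum_m x_m a_m$, and $\mathcal A(x)$ is the set of vectors $\mathbf a$ of non-negative integers with $a_m\le\min[A_{m,\max},s_m]$ for all $m$ and $c(\mathbf a,x)\le c_{\max}$, where $A_{m,\max}$ and $c_{\max}$ are finite and non-negative. Prices of product $k$ lie in a nonempty compact set $\mathcal P_k\subset[0,\infty)$. The demand $D_k(t)$ is an integer in $\{0,\dots,D_{k,\max}\}$; given everything known when the decisions $\mathbf A(t),\mathbf Z(t),\mathbf P(t)$ of slot $t$ have been made, its law depends only on $P_k(t)$ and $Y(t)$, and is the same for all slots. Its mean, given $P_k(t)=p$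 and $Y(t)=y$, is $F_k(p,y)$, assumed continuous in $p\in\mathcal P_k$ for each $y\in\mathcal Y$. A (causal) control algorithm chooses in every slot, from the information available before the demands of that slot (possibly with randomization), $\mathbf A(t)\in\mathcal A(X(t))$, $Z_k(t)\in\{0,1\}$ and $P_k(t)\in\mathcal P_k$; after the demands are seen, it chooses non-negative integers $\tilde D_k(t)\le Z_k(t)D_k(t)$ with $\sum_k\beta_{mk}\tilde D_k(t)\le Q_m(t)$ for all $m$. The buffers are infinite, and the inventories $Q_m(t)\in\{0,1,2,\dots\}$ satisfy $$Q_m(t+1)=\max\Big[Q_m(t)-\sum_{k}\beta_{mk}\tilde D_k(t),0\Big]+A_m(t).$$ The actual profit of slot $t$ is $$\phi_{actual}(t)=-c(\mathbf A(t),X(t))+\sum_{k=1}^K Z_k(t)\tilde D_k(t)(P_k(t)-\alpha_k).$$ **Theorem 1 (Maximum Time Average Profit).** Suppose that $\mathbb E[Q_m(0)]<\infty$ for all $m$. Then the expectations $\mathbb E[\phi_{actual}(\tau)]$ are well defined and, under any control algorithm, $$\limsup_{t\to\infty}\frac1t\sum_{\tau=0}^{t-1}\mathbb E[\phi_{actual}(\tau)]\le\phi^{opt},$$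 where $\phi^{opt}$ is the maximum value (which is attained) of $$\phi=-\hat c+\hat r\quad\text{subject to}\quad \hat a_m\ge\hat\mu_m\ \ (1\le m\le M),$$ $$\hat c=\sum_{x}\pi(x)\sum_{\mathbf a\in\mathcal A(x)}\theta(\mathbf a,x)c(\mathbf a,x),\qquad \hat a_m=\sum_{x}\pi(x)\sum_{\mathbf a\in\mathcal A(x)}\theta(\mathbf a,x)a_m,$$ $$\hat r=\sum_{y}\pi(y)\sum_{k=1}^K\mathbb E_y\big[Z_k(P_k-\alpha_k)F_k(P_k,y)\big],\qquad \hat\mu_m=\sum_{y}\pi(y)\sum_{k=1}^K\beta_{mk}\,\mathbb E_y\big[Z_kF_k(P_k,y)\big].$$ The maximum is over all $\theta$ with $0\le\theta(\mathbf a,x)\le1$ for $\mathbf a\in\mathcal A(x)$ and $\sum_{\mathbf a\in\mathcal A(x)}\theta(\mathbf a,x)=1$ for every $x\in\mathcal X$, and over all families, indexed by $y\in\mathcal Y$, of probability distributions of $(\mathbf Z,\mathbf P)\in\{0,1\}^K\times\prod_k\mathcal P_k$; $\mathbb E_y$ is the expectation under the distribution for $y$. -/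

import Mathlib

open MeasureTheory Filter
open scoped NNReal ENNReal

noncomputable section

/-- The fixed data of a plant with `M` raw materials and `K` products, supply states in `𝒳` and
demand states in `𝒴`. -/
structure Plant (M K : ℕ) (𝒳 𝒴 : Type*) where
  /-- `β m k`: units of material `m` needed for one item of product `k`. -/
  β : Fin M → Fin K → ℕ
  /-- Assembly cost of one item of product `k`. -/
  α : Fin K → ℝ≥0
  /-- The price options of product `k`: a compact set of non-negative prices. -/
  prices : Fin K → Set ℝ
  prices_nonneg : ∀ k, ∀ p ∈ prices k, 0 ≤ p
  prices_compact : ∀ k, IsCompact (prices k)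
  prices_nonempty : ∀ k, (prices k).Nonempty
  /-- The deterministic bound on the demand for product `k` in one slot. -/
  maxDemand : Fin K → ℕ
  /-- The law of the demand for product `k`, given its price and the demand state. -/
  demandLaw : ∀ k, prices k → 𝒴 → PMF (Fin (maxDemand k + 1))
  /-- The mean demand is continuous in the price, for each demand state. -/
  demand_continuous : ∀ k y,
    Continuous fun p : prices k => ∑ n : Fin (maxDemand k + 1), ((n : ℕ) : ℝ) * (demandLaw k p y n).toReal
  /-- `unitPrice x m`: the per-unit price of material `m` in supply state `x`. -/
  unitPrice : 𝒳 → Fin M → ℝ≥0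
  /-- `available x m`: the amount of material `m` for sale in supply state `x`. -/
  available : 𝒳 → Fin M → ℝ≥0
  /-- The bound on the amount of material `m` purchased in one slot. -/
  maxPurchase : Fin M → ℕ
  /-- The bound on the total purchasing cost in one slot. -/
  maxCost : ℝ≥0
  /-- The steady state distribution of the supply state. -/
  πX : PMF 𝒳
  /-- The steady state distribution of the demand state. -/
  πY : PMF 𝒴

namespace Plant

variable {M K : ℕ} {𝒳 𝒴 : Type*}

/-- The demand function `F_k(p, y)`: the mean demand for product `k` at price `p`. -/
def demandFn (S : Plant M K 𝒳 𝒴) (k : Fin K) (p : S.prices k) (y : 𝒴) : ℝ :=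
  ∑ n : Fin (S.maxDemand k + 1), ((n : ℕ) : ℝ) * (S.demandLaw k p y n).toReal

/-- The purchasing cost `c(a, x)`. -/
def cost (S : Plant M K 𝒳 𝒴) (a : Fin M → ℕ) (x : 𝒳) : ℝ :=
  ∑ m, (S.unitPrice x m : ℝ) * (a m : ℝ)

open Classical in
/-- The (finite) set `𝒜(x)` of purchase vectors allowed in supply state `x`. -/
def purchaseSet (S : Plant M K 𝒳 𝒴) (x : 𝒳) : Finset (Fin M → ℕ) :=
  (Fintype.piFinset fun m => Finset.range (S.maxPurchase m + 1)).filter fun a =>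
    (∀ m, (a m : ℝ) ≤ S.available x m) ∧ S.cost a x ≤ S.maxCost

/-- The pairs `(z, p)` of an offer vector (`z k = true` iff product `k` is offered) and a price
vector. -/
abbrev Offer (S : Plant M K 𝒳 𝒴) : Type :=
  (Fin K → Bool) × (∀ k, S.prices k)

/-- The binary variable `Z_k` as a number. -/
def ind (b : Bool) : ℕ := if b then 1 else 0

/-- A stationary randomized policy: for each supply state `x` a probability vector `θ(·, x)` on
`𝒜(x)`, and for each demand state `y` a probability distribution of `(Z, P)`. -/
structure StationaryPolicy (S : Plant M K 𝒳 𝒴) where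
  θ : (Fin M → ℕ) → 𝒳 → ℝ
  θ_mem : ∀ x, ∀ a ∈ S.purchaseSet x, 0 ≤ θ a x ∧ θ a x ≤ 1
  θ_sum : ∀ x, ∑ a ∈ S.purchaseSet x, θ a x = 1
  offerLaw : 𝒴 → Measure S.Offer
  offerLaw_prob : ∀ y, IsProbabilityMeasure (offerLaw y)

namespace StationaryPolicy

variable {S : Plant M K 𝒳 𝒴}

/-- The average purchasing cost `ĉ`. -/
def avgCost (π : S.StationaryPolicy) : ℝ :=
  ∑' x, (S.πX x).toReal * ∑ a ∈ S.purchaseSet x, π.θ a x * S.cost a x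

/-- The average revenue `r̂`, net of assembly costs. -/
def avgRevenue (π : S.StationaryPolicy) : ℝ :=
  ∑' y, (S.πY y).toReal * ∑ k,
    ∫ o, (ind (o.1 k) : ℝ) * (((o.2 k : ℝ) - S.α k) * S.demandFn k (o.2 k) y) ∂(π.offerLaw y)

/-- The average arrival rate `â_m` of material `m`. -/
def arrivalRate (π : S.StationaryPolicy) (m : Fin M) : ℝ :=
  ∑' x, (S.πX x).toReal * ∑ a ∈ S.purchaseSet x, π.θ a x * (a m : ℝ)

/-- The average departure rate `μ̂_m` of material `m`. -/
def departureRate (π : S.StationaryPolicy) (m : Fin M) : ℝ :=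
  ∑' y, (S.πY y).toReal * ∑ k, (S.β m k : ℝ) *
    ∫ o, (ind (o.1 k) : ℝ) * S.demandFn k (o.2 k) y ∂(π.offerLaw y)

end StationaryPolicy

/-- The values that the objective `φ` takes on the feasible set of the optimization problem. -/
def feasibleProfits (S : Plant M K 𝒳 𝒴) : Set ℝ :=
  {φ | ∃ π : S.StationaryPolicy,
    (∀ m, π.departureRate m ≤ π.arrivalRate m) ∧ φ = -π.avgCost + π.avgRevenue}

/-- The optimal value `φ^opt` of the optimization problem. -/
def optProfit (S : Plant M K 𝒳 𝒴) : ℝ := sSup S.feasibleProfits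

/-- The plant with infinite buffers, operated by a causal control algorithm on a probability space
`(Ω, μ)`. The σ-algebra `info t` holds everything known when the purchases, offers and prices of
slot `t` are fixed (the past, the current inventory and states, and any private randomization);
the demands of slot `t` come after that, and the scheduling decision comes after the demands. -/
structure Run (S : Plant M K 𝒳 𝒴) [MeasurableSpace 𝒳] [MeasurableSpace 𝒴]
    {Ω : Type*} [mΩ : MeasurableSpace Ω] (μ : Measure Ω) where
  /-- The information available in each slot, before the demands. -/
  info : Filtration ℕ mΩ
  /-- Supply state. -/
  X : ℕ → Ω → 𝒳
  /-- Demand state. -/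
  Y : ℕ → Ω → 𝒴
  /-- Inventory vector. -/
  Q : ℕ → Ω → Fin M → ℕ
  /-- Purchase vector. -/
  A : ℕ → Ω → Fin M → ℕ
  /-- Offer vector. -/
  Z : ℕ → Ω → Fin K → Bool
  /-- Price vector. -/
  P : ℕ → Ω → ∀ k, S.prices k
  /-- Demand vector. -/
  D : ℕ → Ω → ∀ k, Fin (S.maxDemand k + 1)
  /-- Numbers of products actually sold. -/
  sold : ℕ → Ω → Fin K → ℕ
  measurable_X : ∀ t, Measurable[info t] (X t)
  measurable_Y : ∀ t, Measurable[info t] (Y t)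
  measurable_Q : ∀ t, Measurable[info t] (Q t)
  measurable_A : ∀ t, Measurable[info t] (A t)
  measurable_Z : ∀ t, Measurable[info t] (Z t)
  measurable_P : ∀ t, Measurable[info t] (P t)
  measurable_D : ∀ t, Measurable[info (t + 1)] (D t)
  measurable_sold : ∀ t, Measurable[info (t + 1)] (sold t)
  /-- In every slot the supply state has the steady state distribution. -/
  law_X : ∀ t x, μ {ω | X t ω = x} = S.πX x
  /-- In every slot the demand state has the steady state distribution. -/
  law_Y : ∀ t y, μ {ω | Y t ω = y} = S.πY y
  /-- Given the information of slot `t`, the demand for product `k` has the law determined by the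
  current price of `k` and the current demand state. -/
  law_D : ∀ t k n,
    μ[Set.indicator {ω | D t ω k = n} (fun _ => (1 : ℝ)) | info t]
      =ᵐ[μ] fun ω => (S.demandLaw k (P t ω k) (Y t ω) n).toReal
  purchase_mem : ∀ t ω, A t ω ∈ S.purchaseSet (X t ω)
  sold_le : ∀ t ω k, sold t ω k ≤ ind (Z t ω k) * (D t ω k : ℕ)
  sold_available : ∀ t ω m, ∑ k, S.β m k * sold t ω k ≤ Q t ω m
  /-- The queueing dynamics (subtraction in `ℕ` is truncated at `0`). -/
  dynamics : ∀ t ω m, Q (t + 1) ω m = (Q t ω m - ∑ k, S.β m k * sold t ω k) + A t ω m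

/-- The actual profit `φ_actual(t)`. -/
def Run.actualProfit {S : Plant M K 𝒳 𝒴} [MeasurableSpace 𝒳] [MeasurableSpace 𝒴]
    {Ω : Type*} [MeasurableSpace Ω] {μ : Measure Ω} (R : S.Run μ) (t : ℕ) (ω : Ω) : ℝ :=
  -S.cost (R.A t ω) (R.X t ω) +
    ∑ k, (ind (R.Z t ω k) : ℝ) * (R.sold t ω k : ℝ) * ((R.P t ω k : ℝ) - S.α k)

end Plant

end

/-!
The theorem holds because the whole problem takes place in a compact convex set of mean flows, in
finite dimension. Record the purchases of a slot by the vector (cost, amounts), and the sales by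
the vector of pairs (revenue net of assembly costs, number sold), one for each product. In supply
state `x` the means of the first vector under randomized purchases form the polytope `supplyHull x`,
and in demand state `y` the means of the second under randomized offers form `demandHull y`, the
convex hull of a compact set, which is compact by Carathéodory's theorem. Averaging over the states
gives the set `flowSet` of the mean flows of stationary policies. It is convex, and compact by
Tychonoff's theorem, as the sums over the states converge uniformly. Profit and material deficits
are linear in the flow, so the feasible profits form a nonempty compact set and the maximum is
attained (`isGreatest_optProfit`).

Under an arbitrary control algorithm, the mean flow of each single slot is again in `flowSet`
(`meanFlow_mem`). The point is that the mean sales given the information at the decision are a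
fraction of the mean demand, so they are also the mean demand for an offer that is randomly
withdrawn; the conditional mean of the sales therefore lies in the demand hull, and conditioning on
the state gives the claim. By convexity the time averages of the mean flows are in `flowSet` as
well. The material consumed before time `t` is at most the initial stock plus the purchases, so
the deficit of the time average is at most `𝔼[Q 0] / t`. A limit point of the time averages
thus lies in `flowSet` and has no deficit, which makes its profit feasible.
-/

/-! ### Convex hulls of compact sets -/

/-- By Carathéodory's theorem, the convex hull is the image of the compact set of (weights, points)
for `finrank ℝ E + 1` points; shorter combinations are padded with zero weights. -/
theorem IsCompact.convexHull_of_finiteDimensional {E : Type*} [NormedAddCommGroup E]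
    [NormedSpace ℝ E] [FiniteDimensional ℝ E] {s : Set E} (hs : IsCompact s) :
    IsCompact (convexHull ℝ s) := by
  rcases s.eq_empty_or_nonempty with rfl | ⟨e₀, he₀⟩
  · simp
  let n := Module.finrank ℝ E + 1
  let g : (Fin n → ℝ) × (Fin n → E) → E := fun q => ∑ i, q.1 i • q.2 i
  have hg : Continuous g := by fun_prop
  have hK : IsCompact (stdSimplex ℝ (Fin n) ×ˢ Set.univ.pi fun _ : Fin n => s) :=
    (isCompact_stdSimplex ℝ (Fin n)).prod (isCompact_univ_pi fun _ => hs)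
  convert hK.image hg
  ext e
  constructor
  · intro he
    obtain ⟨ι, _, z, w, hzs, hind, hw, hw1, hwe⟩ := eq_pos_convex_span_of_mem_convexHull he
    have hcard : Fintype.card ι ≤ Fintype.card (Fin n) := by
      simpa [n] using hind.card_le_finrank_succ.trans
        (Nat.succ_le_succ (Submodule.finrank_le _))
    obtain ⟨emb⟩ := Function.Embedding.nonempty_of_card_le hcard
    have hout : ∀ j ∉ Set.range emb, Function.extend emb w 0 j = 0 := fun j hj =>
      Function.extend_apply' _ _ _ hj
    refine ⟨(Function.extend emb w 0, Function.extend emb z fun _ => e₀),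
      ⟨⟨fun j => ?_, ?_⟩, ?_⟩, ?_⟩
    · by_cases hj : j ∈ Set.range emb
      · obtain ⟨i, rfl⟩ := hj
        simpa only [emb.injective.extend_apply] using (hw i).le
      · exact (hout j hj).ge
    · rw [← hw1]
      exact (Fintype.sum_of_injective emb emb.injective w _ hout
        fun i => (emb.injective.extend_apply w 0 i).symm).symm
    · intro j _
      by_cases hj : j ∈ Set.range emb
      · obtain ⟨i, rfl⟩ := hj
        simpa only [emb.injective.extend_apply] using hzs ⟨i, rfl⟩
      · have : Function.extend emb z (fun _ => e₀) j = e₀ := Function.extend_apply' _ _ _ hj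
        simpa only [this] using he₀
    · rw [← hwe]
      refine (Fintype.sum_of_injective emb emb.injective _ _ (fun j hj => ?_) fun i => ?_).symm
      · simp only [hout j hj, zero_smul]
      · simp only [emb.injective.extend_apply]
  · rintro ⟨⟨w, z⟩, ⟨⟨hw, hw1⟩, hz⟩, rfl⟩
    exact (convex_convexHull ℝ s).sum_mem (fun i _ => hw i) hw1
      fun i _ => subset_convexHull ℝ s (hz i trivial)

/-! ### Weighted sums of selections from a family of sets -/

/-- The set of all `∑ i, p i • w i`, where `w` selects one point `w i` of every `C i`: the
possible averages of a vector that must lie in `C i` when a random state with law `p` equals `i`. -/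
def weightedSums {ι E : Type*} [NormedAddCommGroup E] [NormedSpace ℝ E] (p : PMF ι)
    (C : ι → Set E) : Set E :=
  (fun w : ι → E => ∑' i, (p i).toReal • w i) '' Set.univ.pi C

section WeightedSums

variable {ι E : Type*} [NormedAddCommGroup E] [NormedSpace ℝ E] {p : PMF ι} {C : ι → Set E}
  {B : ℝ}

theorem PMF.summable_toReal (p : PMF ι) : Summable fun i => (p i).toReal :=
  ENNReal.summable_toReal p.tsum_coe_ne_top

theorem summable_smul_of_norm_le [CompleteSpace E] (p : PMF ι) {w : ι → E}
    (hw : ∀ i, ‖w i‖ ≤ B) : Summable fun i => (p i).toReal • w i :=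
  Summable.of_norm_bounded (p.summable_toReal.mul_right B) fun i => by
    rw [norm_smul, Real.norm_of_nonneg ENNReal.toReal_nonneg]
    exact mul_le_mul_of_nonneg_left (hw i) ENNReal.toReal_nonneg

/-- A product of compact sets is compact, and the weighted sum is continuous on it because it
converges uniformly. -/
theorem isCompact_weightedSums [CompleteSpace E] (hC : ∀ i, IsCompact (C i))
    (hB : ∀ i, ∀ e ∈ C i, ‖e‖ ≤ B) : IsCompact (weightedSums p C) := by
  refine (isCompact_univ_pi hC).image_of_continuousOn
    (continuousOn_tsum (u := fun i => (p i).toReal * B) (fun i => by fun_prop)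
      (p.summable_toReal.mul_right B) fun i w hw => ?_)
  rw [norm_smul, Real.norm_of_nonneg ENNReal.toReal_nonneg]
  exact mul_le_mul_of_nonneg_left (hB i _ (hw i trivial)) ENNReal.toReal_nonneg

theorem convex_weightedSums [CompleteSpace E] (hC : ∀ i, Convex ℝ (C i))
    (hB : ∀ i, ∀ e ∈ C i, ‖e‖ ≤ B) : Convex ℝ (weightedSums p C) := by
  rintro _ ⟨v, hv, rfl⟩ _ ⟨w, hw, rfl⟩ a b ha hb hab
  refine ⟨fun i => a • v i + b • w i,
    fun i _ => hC i (hv i trivial) (hw i trivial) ha hb hab, ?_⟩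
  have h1 := summable_smul_of_norm_le p fun i => hB i _ (hv i trivial)
  have h2 := summable_smul_of_norm_le p fun i => hB i _ (hw i trivial)
  change ∑' i, (p i).toReal • (a • v i + b • w i) = _
  rw [← h1.tsum_const_smul a, ← h2.tsum_const_smul b,
    ← (h1.const_smul a).tsum_add (h2.const_smul b)]
  exact tsum_congr fun i => by rw [smul_add, smul_comm, smul_comm _ b]

/-- Conditioning on the state: the mean of `f` is the weighted sum of its means over the events
`{N = i}`, each of which lies in the closed convex set `C i`. -/
theorem integral_mem_weightedSums [CompleteSpace E] [Countable ι] [MeasurableSpace ι]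
    [DiscreteMeasurableSpace ι] {Ω : Type*} [MeasurableSpace Ω] {μ : Measure Ω}
    [IsProbabilityMeasure μ] (hC : ∀ i, Convex ℝ (C i)) (hcl : ∀ i, IsClosed (C i))
    (hne : ∀ i, (C i).Nonempty) {N : Ω → ι} (hN : Measurable N)
    (hlaw : ∀ i, μ {ω | N ω = i} = p i) {f : Ω → E} (hf : Integrable f μ)
    (hmem : ∀ᵐ ω ∂μ, f ω ∈ C (N ω)) : ∫ ω, f ω ∂μ ∈ weightedSums p C := by
  classical
  have hms : ∀ i, MeasurableSet {ω | N ω = i} := fun i => hN (measurableSet_singleton i)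
  refine ⟨fun i => if p i = 0 then (hne i).some else ⨍ ω in {ω | N ω = i}, f ω ∂μ,
    fun i _ => ?_, ?_⟩
  · dsimp only
    split_ifs with h
    · exact (hne i).some_mem
    · refine (hC i).set_average_mem (hcl i) (by rwa [hlaw]) (measure_ne_top _ _) ?_ hf.integrableOn
      filter_upwards [ae_restrict_of_ae hmem, ae_restrict_mem (hms i)] with ω h1 h2
      exact (show N ω = i from h2) ▸ h1
  · have hU : ⋃ i, {ω | N ω = i} = Set.univ := by ext; simp
    have hs := hasSum_integral_iUnion (f := f) (μ := μ) hms
      (fun i j hij => Set.disjoint_left.2 fun ω h1 h2 => hij (h1.symm.trans h2)) hf.integrableOn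
    rw [hU, setIntegral_univ] at hs
    rw [← hs.tsum_eq]
    refine tsum_congr fun i => ?_
    dsimp only
    split_ifs with h
    · rw [Measure.restrict_eq_zero.2 ((hlaw i).trans h)]
      simp [h]
    · rw [setAverage_eq, measureReal_def, hlaw, smul_inv_smul₀]
      exact ENNReal.toReal_ne_zero.2 ⟨h, p.apply_ne_top i⟩

end WeightedSums

noncomputable section

namespace Plant

variable {M K : ℕ} {𝒳 𝒴 : Type*}

/-! ### Conditional means of costs, flows and revenues -/

/-- The cost and the amounts of material that the purchase vector `a` brings in state `x`. -/
def supplyPoint (S : Plant M K 𝒳 𝒴) (x : 𝒳) (a : Fin M → ℕ) : ℝ × (Fin M → ℝ) :=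
  (S.cost a x, fun m => (a m : ℝ))

/-- The mean revenue (net of assembly costs) and the mean demand, product by product, that the
offer `o` generates in demand state `y`. -/
def demandPoint (S : Plant M K 𝒳 𝒴) (y : 𝒴) (o : S.Offer) : Fin K → ℝ × ℝ := fun k =>
  ((ind (o.1 k) : ℝ) * (((o.2 k : ℝ) - S.α k) * S.demandFn k (o.2 k) y),
    (ind (o.1 k) : ℝ) * S.demandFn k (o.2 k) y)

/-- The means of `supplyPoint` under randomized purchases in state `x`. -/
def supplyHull (S : Plant M K 𝒳 𝒴) (x : 𝒳) : Set (ℝ × (Fin M → ℝ)) :=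
  convexHull ℝ (S.supplyPoint x '' (S.purchaseSet x : Set (Fin M → ℕ)))

/-- The means of `demandPoint` under randomized offers in state `y`. -/
def demandHull (S : Plant M K 𝒳 𝒴) (y : 𝒴) : Set (Fin K → ℝ × ℝ) :=
  convexHull ℝ (Set.range (S.demandPoint y))

theorem ind_le_one (b : Bool) : (ind b : ℝ) ≤ 1 := by cases b <;> simp [ind]

theorem zero_mem_purchaseSet (S : Plant M K 𝒳 𝒴) (x : 𝒳) : 0 ∈ S.purchaseSet x := by
  rw [purchaseSet, Finset.mem_filter]
  simp [cost]

instance (S : Plant M K 𝒳 𝒴) (k : Fin K) : CompactSpace (S.prices k) :=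
  isCompact_iff_compactSpace.1 (S.prices_compact k)

instance (S : Plant M K 𝒳 𝒴) (k : Fin K) : Nonempty (S.prices k) :=
  (S.prices_nonempty k).to_subtype

theorem demandFn_nonneg (S : Plant M K 𝒳 𝒴) (k : Fin K) (p : S.prices k) (y : 𝒴) :
    0 ≤ S.demandFn k p y :=
  Finset.sum_nonneg fun _ _ => by positivity

theorem demandFn_le (S : Plant M K 𝒳 𝒴) (k : Fin K) (p : S.prices k) (y : 𝒴) :
    S.demandFn k p y ≤ S.maxDemand k := by
  have h1 : ∑ n, (S.demandLaw k p y n).toReal = 1 := by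
    rw [← ENNReal.toReal_sum fun n _ => (S.demandLaw k p y).apply_ne_top n,
      ← tsum_fintype (L := .unconditional _),
      (S.demandLaw k p y).tsum_coe, ENNReal.toReal_one]
  calc S.demandFn k p y
      ≤ ∑ n : Fin (S.maxDemand k + 1), (S.maxDemand k : ℝ) * (S.demandLaw k p y n).toReal :=
        Finset.sum_le_sum fun n _ => mul_le_mul_of_nonneg_right
          (by exact_mod_cast Nat.le_of_lt_succ n.2) ENNReal.toReal_nonneg
    _ = S.maxDemand k := by rw [← Finset.mul_sum, h1, mul_one]

theorem continuous_demandPoint (S : Plant M K 𝒳 𝒴) (y : 𝒴) : Continuous (S.demandPoint y) := by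
  have hind : ∀ k, Continuous fun o : S.Offer => (ind (o.1 k) : ℝ) := fun k =>
    (continuous_of_discreteTopology (f := fun b : Bool => (ind b : ℝ))).comp (by fun_prop)
  have hF : ∀ k, Continuous fun o : S.Offer => S.demandFn k (o.2 k) y := fun k =>
    (S.demand_continuous k y).comp (by fun_prop)
  refine continuous_pi fun k => ?_
  have h1 := hind k
  have h2 := hF k
  unfold demandPoint
  fun_prop

theorem exists_abs_price_sub_le (S : Plant M K 𝒳 𝒴) :
    ∃ B : ℝ, 0 ≤ B ∧ ∀ k, ∀ p : S.prices k, |(p : ℝ) - S.α k| ≤ B := by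
  have h : ∀ k, ∃ B : ℝ, ∀ p : S.prices k, |(p : ℝ) - S.α k| ≤ B := fun k => by
    obtain ⟨B, hB⟩ := (S.prices_compact k).exists_bound_of_continuousOn
      (f := fun p : ℝ => p - S.α k) (by fun_prop)
    exact ⟨B, fun p => hB p p.2⟩
  choose B hB using h
  refine ⟨∑ k, |B k|, by positivity, fun k p => ?_⟩
  exact (hB k p).trans ((le_abs_self _).trans
    (Finset.single_le_sum (f := fun k => |B k|) (fun _ _ => abs_nonneg _) (Finset.mem_univ k)))

theorem exists_norm_demandHull_le (S : Plant M K 𝒳 𝒴) :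
    ∃ B : ℝ, ∀ y, ∀ v ∈ S.demandHull y, ‖v‖ ≤ B := by
  obtain ⟨B, hB0, hB⟩ := S.exists_abs_price_sub_le
  let C : ℝ := ∑ k, (S.maxDemand k : ℝ)
  have hC0 : 0 ≤ C := by positivity
  refine ⟨B * C + C, fun y v hv => ?_⟩
  have hsub : S.demandHull y ⊆ Metric.closedBall 0 (B * C + C) := by
    refine convexHull_min ?_ (convex_closedBall 0 _)
    rintro _ ⟨o, rfl⟩
    have hBC : 0 ≤ B * C := by positivity
    rw [mem_closedBall_zero_iff, pi_norm_le_iff_of_nonneg (by positivity)]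
    intro k
    have hF0 := S.demandFn_nonneg k (o.2 k) y
    have hF : S.demandFn k (o.2 k) y ≤ C := (S.demandFn_le k (o.2 k) y).trans
      (Finset.single_le_sum (f := fun k => (S.maxDemand k : ℝ)) (fun _ _ => by positivity)
        (Finset.mem_univ k))
    have hi0 : (0 : ℝ) ≤ ind (o.1 k) := by positivity
    have hi1 := ind_le_one (o.1 k)
    rw [Prod.norm_def, max_le_iff]
    constructor
    · simp only [demandPoint, Real.norm_eq_abs, abs_mul, abs_of_nonneg hi0, abs_of_nonneg hF0]
      calc _ ≤ 1 * (B * C) := by gcongr; exact hB k _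
        _ ≤ _ := by linarith
    · simp only [demandPoint, Real.norm_eq_abs, abs_mul, abs_of_nonneg hi0, abs_of_nonneg hF0]
      calc _ ≤ 1 * C := by gcongr
        _ ≤ _ := by linarith
  simpa using hsub hv

theorem cost_nonneg (S : Plant M K 𝒳 𝒴) (a : Fin M → ℕ) (x : 𝒳) : 0 ≤ S.cost a x :=
  Finset.sum_nonneg fun _ _ => by positivity

theorem norm_supplyPoint_le (S : Plant M K 𝒳 𝒴) {x : 𝒳} {a : Fin M → ℕ}
    (ha : a ∈ S.purchaseSet x) :
    ‖S.supplyPoint x a‖ ≤ S.maxCost + ∑ m, (S.maxPurchase m : ℝ) := by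
  simp only [purchaseSet, Finset.mem_filter, Fintype.mem_piFinset, Finset.mem_range] at ha
  obtain ⟨h1, -, h3⟩ := ha
  have hs : (0 : ℝ) ≤ ∑ m, (S.maxPurchase m : ℝ) := by positivity
  have hc : (0 : ℝ) ≤ S.maxCost := S.maxCost.2
  rw [Prod.norm_def, max_le_iff, pi_norm_le_iff_of_nonneg (by positivity)]
  constructor
  · simp only [supplyPoint, Real.norm_eq_abs, abs_of_nonneg (S.cost_nonneg a x)]
    linarith
  · intro m
    simp only [supplyPoint, Real.norm_eq_abs, Nat.abs_cast]
    have h4 : (a m : ℝ) ≤ S.maxPurchase m := by exact_mod_cast Nat.le_of_lt_succ (h1 m)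
    have h5 := Finset.single_le_sum (f := fun m => (S.maxPurchase m : ℝ))
      (fun _ _ => by positivity) (Finset.mem_univ m)
    linarith

theorem norm_supplyHull_le (S : Plant M K 𝒳 𝒴) (x : 𝒳) :
    ∀ u ∈ S.supplyHull x, ‖u‖ ≤ S.maxCost + ∑ m, (S.maxPurchase m : ℝ) := by
  intro u hu
  have hsub : S.supplyHull x ⊆
      Metric.closedBall 0 ((S.maxCost : ℝ) + ∑ m, (S.maxPurchase m : ℝ)) := by
    refine convexHull_min ?_ (convex_closedBall 0 _)
    rintro _ ⟨a, ha, rfl⟩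
    simpa using S.norm_supplyPoint_le ha
  simpa using hsub hu

theorem isCompact_supplyHull (S : Plant M K 𝒳 𝒴) (x : 𝒳) : IsCompact (S.supplyHull x) :=
  ((S.purchaseSet x).finite_toSet.image _).isCompact_convexHull ℝ

theorem isCompact_demandHull (S : Plant M K 𝒳 𝒴) (y : 𝒴) : IsCompact (S.demandHull y) :=
  (isCompact_range (S.continuous_demandPoint y)).convexHull_of_finiteDimensional

theorem supplyHull_nonempty (S : Plant M K 𝒳 𝒴) (x : 𝒳) : (S.supplyHull x).Nonempty :=
  ⟨_, subset_convexHull ℝ _ ⟨0, S.zero_mem_purchaseSet x, rfl⟩⟩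

theorem demandHull_nonempty (S : Plant M K 𝒳 𝒴) (y : 𝒴) : (S.demandHull y).Nonempty :=
  (Set.range_nonempty _).convexHull

theorem integrable_demandPoint (S : Plant M K 𝒳 𝒴) (y : 𝒴) (ν : Measure S.Offer)
    [IsFiniteMeasure ν] : Integrable (S.demandPoint y) ν := by
  obtain ⟨B, hB⟩ := S.exists_norm_demandHull_le
  exact Integrable.of_bound (S.continuous_demandPoint y).aestronglyMeasurable B
    (ae_of_all _ fun o => hB y _ (subset_convexHull ℝ _ ⟨o, rfl⟩))

/-- Random offers generate exactly the points of the demand hull: the mean of a random vector lies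
in the closed convex hull of its values, and finite mixtures of offers attain the whole hull. -/
theorem mem_demandHull_iff (S : Plant M K 𝒳 𝒴) (y : 𝒴) (v : Fin K → ℝ × ℝ) :
    v ∈ S.demandHull y ↔
      ∃ ν : Measure S.Offer, IsProbabilityMeasure ν ∧ v = ∫ o, S.demandPoint y o ∂ν := by
  constructor
  · intro hv
    refine (convexHull_min (s := Set.range (S.demandPoint y)) (t := {v | ∃ ν : Measure S.Offer,
      IsProbabilityMeasure ν ∧ v = ∫ o, S.demandPoint y o ∂ν}) ?_ ?_) hv
    · rintro _ ⟨o, rfl⟩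
      exact ⟨Measure.dirac o, inferInstance, by rw [integral_dirac]⟩
    · rintro _ ⟨ν, hν, rfl⟩ _ ⟨ν', hν', rfl⟩ a b ha hb hab
      refine ⟨ENNReal.ofReal a • ν + ENNReal.ofReal b • ν', ⟨?_⟩, ?_⟩
      · simp [← ENNReal.ofReal_add ha hb, hab]
      · rw [integral_add_measure ((S.integrable_demandPoint y ν).smul_measure ENNReal.ofReal_ne_top)
            ((S.integrable_demandPoint y ν').smul_measure ENNReal.ofReal_ne_top),
          integral_smul_measure, integral_smul_measure, ENNReal.toReal_ofReal ha,
          ENNReal.toReal_ofReal hb]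
  · rintro ⟨ν, hν, rfl⟩
    exact (convex_convexHull ℝ _).integral_mem (S.isCompact_demandHull y).isClosed
      (ae_of_all _ fun o => subset_convexHull ℝ _ ⟨o, rfl⟩) (S.integrable_demandPoint y ν)

theorem mem_supplyHull_iff (S : Plant M K 𝒳 𝒴) (x : 𝒳) (u : ℝ × (Fin M → ℝ)) :
    u ∈ S.supplyHull x ↔ ∃ θ : (Fin M → ℕ) → ℝ, (∀ a ∈ S.purchaseSet x, 0 ≤ θ a) ∧
      ∑ a ∈ S.purchaseSet x, θ a = 1 ∧ u = ∑ a ∈ S.purchaseSet x, θ a • S.supplyPoint x a := by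
  classical
  constructor
  · intro hu
    refine (convexHull_min (s := S.supplyPoint x '' (S.purchaseSet x : Set (Fin M → ℕ)))
      (t := {u | ∃ θ : (Fin M → ℕ) → ℝ, (∀ a ∈ S.purchaseSet x, 0 ≤ θ a) ∧
        ∑ a ∈ S.purchaseSet x, θ a = 1 ∧ u = ∑ a ∈ S.purchaseSet x, θ a • S.supplyPoint x a})
      ?_ ?_) hu
    · rintro _ ⟨a, ha, rfl⟩
      refine ⟨fun b => if b = a then 1 else 0, fun b _ => by dsimp only; split_ifs <;> simp, ?_, ?_⟩
      · simpa using ha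
      · simp [Finset.mem_coe.1 ha]
    · rintro _ ⟨θ, h0, h1, rfl⟩ _ ⟨θ', h0', h1', rfl⟩ a b ha hb hab
      refine ⟨fun c => a * θ c + b * θ' c, fun c hc => ?_, ?_, ?_⟩
      · have := h0 c hc
        have := h0' c hc
        positivity
      · rw [Finset.sum_add_distrib, ← Finset.mul_sum, ← Finset.mul_sum, h1, h1']
        linarith
      · simp only [add_smul, mul_smul, Finset.sum_add_distrib, Finset.smul_sum]
  · rintro ⟨θ, h0, h1, rfl⟩
    exact (convex_convexHull ℝ _).sum_mem h0 h1 fun a ha => subset_convexHull ℝ _ ⟨a, ha, rfl⟩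

/-! ### The feasible set of the optimization problem -/

/-- The pairs (mean cost and arrivals, mean revenues and demands) that stationary randomized
policies generate. -/
def flowSet (S : Plant M K 𝒳 𝒴) : Set ((ℝ × (Fin M → ℝ)) × (Fin K → ℝ × ℝ)) :=
  weightedSums S.πX S.supplyHull ×ˢ weightedSums S.πY S.demandHull

/-- The profit of a flow. -/
def flowProfit (q : (ℝ × (Fin M → ℝ)) × (Fin K → ℝ × ℝ)) : ℝ :=
  -q.1.1 + ∑ k, (q.2 k).1

/-- The consumption of material `m` minus the purchases of `m` in a flow. -/
def flowDeficit (S : Plant M K 𝒳 𝒴) (m : Fin M)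
    (q : (ℝ × (Fin M → ℝ)) × (Fin K → ℝ × ℝ)) : ℝ :=
  ∑ k, (S.β m k : ℝ) * (q.2 k).2 - q.1.2 m

theorem isCompact_flowSet (S : Plant M K 𝒳 𝒴) : IsCompact S.flowSet := by
  obtain ⟨B, hB⟩ := S.exists_norm_demandHull_le
  exact (isCompact_weightedSums S.isCompact_supplyHull S.norm_supplyHull_le).prod
    (isCompact_weightedSums S.isCompact_demandHull hB)

theorem convex_flowSet (S : Plant M K 𝒳 𝒴) : Convex ℝ S.flowSet := by
  obtain ⟨B, hB⟩ := S.exists_norm_demandHull_le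
  exact (convex_weightedSums (fun _ => convex_convexHull ℝ _) S.norm_supplyHull_le).prod
    (convex_weightedSums (fun _ => convex_convexHull ℝ _) hB)

theorem continuous_flowProfit :
    Continuous (flowProfit : (ℝ × (Fin M → ℝ)) × (Fin K → ℝ × ℝ) → ℝ) := by
  unfold flowProfit; fun_prop

theorem continuous_flowDeficit (S : Plant M K 𝒳 𝒴) (m : Fin M) :
    Continuous (S.flowDeficit m) := by
  unfold flowDeficit; fun_prop

namespace StationaryPolicy

variable {S : Plant M K 𝒳 𝒴}

/-- The mean cost and purchases of a policy in supply state `x`. -/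
def supplyMean (π : S.StationaryPolicy) (x : 𝒳) : ℝ × (Fin M → ℝ) :=
  ∑ a ∈ S.purchaseSet x, π.θ a x • S.supplyPoint x a

/-- The mean revenues and demands of a policy in demand state `y`. -/
def demandMean (π : S.StationaryPolicy) (y : 𝒴) : Fin K → ℝ × ℝ :=
  ∫ o, S.demandPoint y o ∂(π.offerLaw y)

theorem supplyMean_mem (π : S.StationaryPolicy) (x : 𝒳) : π.supplyMean x ∈ S.supplyHull x :=
  (S.mem_supplyHull_iff x _).2
    ⟨fun a => π.θ a x, fun a ha => (π.θ_mem x a ha).1, π.θ_sum x, rfl⟩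

theorem demandMean_mem (π : S.StationaryPolicy) (y : 𝒴) : π.demandMean y ∈ S.demandHull y :=
  (S.mem_demandHull_iff y _).2 ⟨_, π.offerLaw_prob y, rfl⟩

theorem demandMean_apply (π : S.StationaryPolicy) (y : 𝒴) (k : Fin K) :
    π.demandMean y k =
      (∫ o, (ind (o.1 k) : ℝ) * (((o.2 k : ℝ) - S.α k) * S.demandFn k (o.2 k) y) ∂(π.offerLaw y),
        ∫ o, (ind (o.1 k) : ℝ) * S.demandFn k (o.2 k) y ∂(π.offerLaw y)) := by
  have := π.offerLaw_prob y
  have h := S.integrable_demandPoint y (π.offerLaw y)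
  have hk : ∀ k, Integrable (fun o => S.demandPoint y o k) (π.offerLaw y) := h.eval
  rw [demandMean, eval_integral hk]
  exact integral_pair (hk k).fst (hk k).snd

/-- The flow of a policy, averaged over the states. -/
def flow (π : S.StationaryPolicy) : (ℝ × (Fin M → ℝ)) × (Fin K → ℝ × ℝ) :=
  (∑' x, (S.πX x).toReal • π.supplyMean x, ∑' y, (S.πY y).toReal • π.demandMean y)

theorem flow_mem (π : S.StationaryPolicy) : π.flow ∈ S.flowSet :=
  ⟨⟨_, fun x _ => π.supplyMean_mem x, rfl⟩, ⟨_, fun y _ => π.demandMean_mem y, rfl⟩⟩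

theorem map_flow_fst (π : S.StationaryPolicy) (L : (ℝ × (Fin M → ℝ)) →L[ℝ] ℝ) :
    L π.flow.1 = ∑' x, (S.πX x).toReal * L (π.supplyMean x) := by
  rw [flow, L.map_tsum (summable_smul_of_norm_le _ fun x =>
    S.norm_supplyHull_le x _ (π.supplyMean_mem x))]
  simp

theorem map_flow_snd (π : S.StationaryPolicy) (L : (Fin K → ℝ × ℝ) →L[ℝ] ℝ) :
    L π.flow.2 = ∑' y, (S.πY y).toReal * L (π.demandMean y) := by
  obtain ⟨B, hB⟩ := S.exists_norm_demandHull_le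
  rw [flow, L.map_tsum (summable_smul_of_norm_le _ fun y => hB y _ (π.demandMean_mem y))]
  simp

theorem flowProfit_flow (π : S.StationaryPolicy) :
    flowProfit π.flow = -π.avgCost + π.avgRevenue := by
  have h1 := π.map_flow_fst (ContinuousLinearMap.fst ℝ ℝ (Fin M → ℝ))
  have h2 := π.map_flow_snd
    (∑ k, (ContinuousLinearMap.fst ℝ ℝ ℝ).comp (ContinuousLinearMap.proj k))
  simp only [ContinuousLinearMap.coe_fst', _root_.sum_apply,
    ContinuousLinearMap.comp_apply, ContinuousLinearMap.proj_apply] at h1 h2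
  rw [flowProfit, h1, h2, avgCost, avgRevenue]
  simp only [demandMean_apply, supplyMean, Prod.fst_sum, Prod.smul_fst, supplyPoint, smul_eq_mul]

theorem flowDeficit_flow (π : S.StationaryPolicy) (m : Fin M) :
    S.flowDeficit m π.flow = π.departureRate m - π.arrivalRate m := by
  have h1 := π.map_flow_fst
    ((ContinuousLinearMap.proj m).comp (ContinuousLinearMap.snd ℝ ℝ (Fin M → ℝ)))
  have h2 := π.map_flow_snd
    (∑ k, (S.β m k : ℝ) • (ContinuousLinearMap.snd ℝ ℝ ℝ).comp (ContinuousLinearMap.proj k))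
  simp only [ContinuousLinearMap.coe_snd', _root_.sum_apply,
    _root_.smul_apply, smul_eq_mul,
    ContinuousLinearMap.comp_apply, ContinuousLinearMap.proj_apply] at h1 h2
  rw [flowDeficit, h1, h2, arrivalRate, departureRate]
  simp only [demandMean_apply, supplyMean, Prod.snd_sum, Prod.smul_snd, supplyPoint, smul_eq_mul,
    Finset.sum_apply, Pi.smul_apply]

end StationaryPolicy

theorem exists_policy_flow_eq (S : Plant M K 𝒳 𝒴) {q : (ℝ × (Fin M → ℝ)) × (Fin K → ℝ × ℝ)}
    (hq : q ∈ S.flowSet) : ∃ π : S.StationaryPolicy, π.flow = q := by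
  obtain ⟨⟨u, hu, hu'⟩, ⟨v, hv, hv'⟩⟩ := hq
  choose θ h0 h1 hθ using fun x => (S.mem_supplyHull_iff x _).1 (hu x trivial)
  choose ν hν hνv using fun y => (S.mem_demandHull_iff y _).1 (hv y trivial)
  let π : S.StationaryPolicy :=
    { θ := fun a x => θ x a
      θ_mem := fun x a ha => ⟨h0 x a ha, h1 x ▸ Finset.single_le_sum (h0 x) ha⟩
      θ_sum := h1
      offerLaw := ν
      offerLaw_prob := hν }
  refine ⟨π, Prod.ext ?_ ?_⟩
  · rw [← hu']
    exact tsum_congr fun x => by rw [hθ x]; rfl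
  · rw [← hv']
    exact tsum_congr fun y => by rw [hνv y]; rfl

theorem feasibleProfits_eq (S : Plant M K 𝒳 𝒴) :
    S.feasibleProfits = flowProfit '' (S.flowSet ∩ {q | ∀ m, S.flowDeficit m q ≤ 0}) := by
  ext φ
  constructor
  · rintro ⟨π, hπ, rfl⟩
    exact ⟨π.flow, ⟨π.flow_mem, fun m => by rw [π.flowDeficit_flow]; linarith [hπ m]⟩,
      π.flowProfit_flow⟩
  · rintro ⟨q, ⟨hq, hd⟩, rfl⟩
    obtain ⟨π, rfl⟩ := S.exists_policy_flow_eq hq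
    exact ⟨π, fun m => by have := hd m; rw [π.flowDeficit_flow] at this; linarith,
      π.flowProfit_flow⟩

theorem isCompact_feasibleProfits (S : Plant M K 𝒳 𝒴) : IsCompact S.feasibleProfits := by
  rw [S.feasibleProfits_eq]
  refine (S.isCompact_flowSet.inter_right ?_).image continuous_flowProfit
  simp only [Set.ofPred_forall]
  exact isClosed_iInter fun m => isClosed_le (S.continuous_flowDeficit m) continuous_const

/-- Buying and offering nothing is feasible. -/
theorem feasibleProfits_nonempty (S : Plant M K 𝒳 𝒴) : S.feasibleProfits.Nonempty := by
  rw [S.feasibleProfits_eq]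
  let o : S.Offer := (fun _ => false, fun _ => Classical.arbitrary _)
  refine ⟨_, 0, ⟨⟨⟨fun _ => 0, fun x _ => ?_, by simp⟩, ⟨fun _ => 0, fun y _ => ?_, by simp⟩⟩,
    fun m => ?_⟩, rfl⟩
  · exact subset_convexHull ℝ _ ⟨0, S.zero_mem_purchaseSet x, by ext <;> simp [supplyPoint, cost]⟩
  · exact subset_convexHull ℝ _ ⟨o, by ext k <;> simp [demandPoint, o, ind]⟩
  · simp [flowDeficit]

theorem isGreatest_optProfit (S : Plant M K 𝒳 𝒴) : IsGreatest S.feasibleProfits S.optProfit :=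
  S.isCompact_feasibleProfits.isGreatest_sSup S.feasibleProfits_nonempty

/-! ### The mean flows of a controlled plant -/

namespace Run

variable [MeasurableSpace 𝒳] [MeasurableSpace 𝒴]
  {S : Plant M K 𝒳 𝒴}
  {Ω : Type*} [mΩ : MeasurableSpace Ω] {μ : Measure Ω}

theorem sold_le_maxDemand (R : S.Run μ) (t : ℕ) (ω : Ω) (k : Fin K) :
    R.sold t ω k ≤ S.maxDemand k := by
  have h1 := R.sold_le t ω k
  have h2 : (R.D t ω k : ℕ) ≤ S.maxDemand k := Nat.le_of_lt_succ (R.D t ω k).2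
  cases h : R.Z t ω k <;> simp [h, ind] at h1 <;> omega

/-- The factor `Z_k` in the profit is redundant, since nothing is sold of a product that is not
offered. -/
theorem actualProfit_eq (R : S.Run μ) (t : ℕ) : R.actualProfit t = fun ω =>
    -S.cost (R.A t ω) (R.X t ω) +
      ∑ k, (R.sold t ω k : ℝ) * ((R.P t ω k : ℝ) - S.α k) := by
  ext ω
  refine congrArg _ (Finset.sum_congr rfl fun k _ => congrArg (· * _) ?_)
  have h := R.sold_le t ω k
  cases hz : R.Z t ω k
  · rw [hz] at h
    have : R.sold t ω k = 0 := by simpa [ind] using h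
    simp [this]
  · simp [ind]

/-- Conservation of material: what has been consumed was in stock initially or was purchased. -/
theorem inventory_add_sum (R : S.Run μ) (m : Fin M) (ω : Ω) (t : ℕ) :
    (R.Q t ω m : ℝ) + ∑ τ ∈ Finset.range t,
      (∑ k, (S.β m k : ℝ) * (R.sold τ ω k : ℝ) - (R.A τ ω m : ℝ)) = R.Q 0 ω m := by
  induction t with
  | zero => simp
  | succ t ih =>
    rw [Finset.sum_range_succ, ← ih, R.dynamics]
    push_cast [Nat.cast_sub (R.sold_available t ω m)]
    ring

theorem stronglyMeasurable_ind_offer (R : S.Run μ) (t : ℕ) (k : Fin K) :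
    StronglyMeasurable[R.info t] fun ω => (ind (R.Z t ω k) : ℝ) :=
  ((measurable_from_top (f := fun b : Bool => (ind b : ℝ))).comp
    ((measurable_pi_apply k).comp (R.measurable_Z t))).stronglyMeasurable

theorem stronglyMeasurable_price (R : S.Run μ) (t : ℕ) (k : Fin K) :
    StronglyMeasurable[R.info t] fun ω => (R.P t ω k : ℝ) - S.α k :=
  ((measurable_subtype_coe.comp ((measurable_pi_apply k).comp (R.measurable_P t))).sub_const
    _).stronglyMeasurable

/-- The mean number of sales of product `k` in slot `t`, given the information at the time of the
decisions. -/
def saleMean (R : S.Run μ) (t : ℕ) (k : Fin K) : Ω → ℝ :=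
  μ[fun ω => (R.sold t ω k : ℝ) | R.info t]

theorem saleMean_nonneg (R : S.Run μ) (t : ℕ) (k : Fin K) : ∀ᵐ ω ∂μ, 0 ≤ R.saleMean t k ω :=
  condExp_nonneg (ae_of_all _ fun ω => by positivity)

/-- The conditional means of revenues and sales in slot `t`, given the information at the time of
the decisions. -/
def saleFlow (R : S.Run μ) (t : ℕ) (ω : Ω) : Fin K → ℝ × ℝ := fun k =>
  (R.saleMean t k ω * ((R.P t ω k : ℝ) - S.α k), R.saleMean t k ω)

/-- The mean costs, purchases, revenues and sales in slot `t`. -/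
def meanFlow (R : S.Run μ) (t : ℕ) : (ℝ × (Fin M → ℝ)) × (Fin K → ℝ × ℝ) :=
  (∫ ω, S.supplyPoint (R.X t ω) (R.A t ω) ∂μ, ∫ ω, R.saleFlow t ω ∂μ)

/-- The time average of the mean flows of the first `t` slots. -/
def avgFlow (R : S.Run μ) (t : ℕ) : (ℝ × (Fin M → ℝ)) × (Fin K → ℝ × ℝ) :=
  (1 / (t : ℝ)) • ∑ τ ∈ Finset.range t, R.meanFlow τ

theorem flowDeficit_avgFlow (R : S.Run μ) (m : Fin M) (t : ℕ) : S.flowDeficit m (R.avgFlow t) =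
    (1 / (t : ℝ)) * ∑ τ ∈ Finset.range t, S.flowDeficit m (R.meanFlow τ) := by
  simp only [avgFlow, flowDeficit, Prod.smul_fst, Prod.smul_snd,
    Prod.fst_sum, Prod.snd_sum, Finset.sum_apply, Pi.smul_apply, smul_eq_mul,
    Finset.sum_sub_distrib]
  rw [Finset.sum_comm, mul_sub]
  simp only [Finset.mul_sum, mul_left_comm]

variable [IsProbabilityMeasure μ]

theorem integrable_sold (R : S.Run μ) (t : ℕ) (k : Fin K) :
    Integrable (fun ω => (R.sold t ω k : ℝ)) μ := by
  have hm : Measurable fun ω => R.sold t ω k :=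
    (measurable_pi_apply k).comp ((R.measurable_sold t).mono (R.info.le _) le_rfl)
  refine Integrable.of_bound (measurable_from_top.comp hm).aestronglyMeasurable
    (S.maxDemand k) (ae_of_all _ fun ω => ?_)
  simpa using R.sold_le_maxDemand t ω k

theorem integrable_demand (R : S.Run μ) (t : ℕ) (k : Fin K) :
    Integrable (fun ω => ((R.D t ω k : ℕ) : ℝ)) μ := by
  have hm : Measurable fun ω => R.D t ω k :=
    (measurable_pi_apply k).comp ((R.measurable_D t).mono (R.info.le _) le_rfl)
  refine Integrable.of_bound ((measurable_of_countable
    (fun n : Fin (S.maxDemand k + 1) => ((n : ℕ) : ℝ))).comp hm).aestronglyMeasurable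
    (S.maxDemand k) (ae_of_all _ fun ω => ?_)
  simpa using Nat.le_of_lt_succ (R.D t ω k).2

theorem condExp_demand (R : S.Run μ) (t : ℕ) (k : Fin K) :
    μ[fun ω => ((R.D t ω k : ℕ) : ℝ) | R.info t]
      =ᵐ[μ] fun ω => S.demandFn k (R.P t ω k) (R.Y t ω) := by
  have hm : Measurable fun ω => R.D t ω k :=
    (measurable_pi_apply k).comp ((R.measurable_D t).mono (R.info.le _) le_rfl)
  have hdec : (fun ω => ((R.D t ω k : ℕ) : ℝ)) = ∑ n : Fin (S.maxDemand k + 1),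
      ((n : ℕ) : ℝ) • Set.indicator {ω | R.D t ω k = n} (fun _ => (1 : ℝ)) := by
    ext ω
    simp [Finset.sum_apply, Set.indicator_apply]
  have hint : ∀ n : Fin (S.maxDemand k + 1),
      Integrable (Set.indicator {ω | R.D t ω k = n} (fun _ => (1 : ℝ))) μ := fun n =>
    (integrable_const _).indicator (hm (measurableSet_singleton n))
  rw [hdec]
  have hall : ∀ᵐ ω ∂μ, ∀ n : Fin (S.maxDemand k + 1),
      (μ[((n : ℕ) : ℝ) • Set.indicator {ω | R.D t ω k = n} (fun _ => (1 : ℝ)) | R.info t]) ω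
        = ((n : ℕ) : ℝ) * (S.demandLaw k (R.P t ω k) (R.Y t ω) n).toReal := by
    refine ae_all_iff.2 fun n => ?_
    filter_upwards [condExp_smul (μ := μ) ((n : ℕ) : ℝ)
      (Set.indicator {ω | R.D t ω k = n} (fun _ => (1 : ℝ))) (R.info t), R.law_D t k n]
      with ω h1 h2
    rw [h1, Pi.smul_apply, h2, smul_eq_mul]
  filter_upwards [condExp_finsetSum (μ := μ) (fun n _ => (hint n).smul ((n : ℕ) : ℝ)) (R.info t),
    hall] with ω h1 h2
  rw [h1, Finset.sum_apply, demandFn]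
  exact Finset.sum_congr rfl fun n _ => h2 n

theorem saleMean_le (R : S.Run μ) (t : ℕ) (k : Fin K) : ∀ᵐ ω ∂μ, R.saleMean t k ω ≤
    (ind (R.Z t ω k) : ℝ) * S.demandFn k (R.P t ω k) (R.Y t ω) := by
  have hZ := R.stronglyMeasurable_ind_offer t k
  have hint : Integrable
      ((fun ω => (ind (R.Z t ω k) : ℝ)) * fun ω => ((R.D t ω k : ℕ) : ℝ)) μ :=
    (R.integrable_demand t k).bdd_mul (c := 1) (hZ.mono (R.info.le t)).aestronglyMeasurable
      (ae_of_all _ fun ω => by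
        simpa only [Real.norm_eq_abs, Nat.abs_cast] using ind_le_one (R.Z t ω k))
  have hle : (fun ω => (R.sold t ω k : ℝ)) ≤ᵐ[μ]
      (fun ω => (ind (R.Z t ω k) : ℝ)) * fun ω => ((R.D t ω k : ℕ) : ℝ) :=
    ae_of_all _ fun ω => by
      have := R.sold_le t ω k
      simp only [Pi.mul_apply]
      exact_mod_cast this
  filter_upwards [condExp_mono (m := R.info t) (R.integrable_sold t k) hint hle,
    condExp_mul_of_stronglyMeasurable_left hZ hint (R.integrable_demand t k),
    R.condExp_demand t k] with ω h1 h2 h3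
  rw [h2, Pi.mul_apply, h3] at h1
  exact h1

/-- The mean sales are a fraction of the mean demand for an offer, hence the mean demand for an
offer that is withdrawn with the complementary probability, independently for each product. -/
theorem saleFlow_mem (R : S.Run μ) (t : ℕ) :
    ∀ᵐ ω ∂μ, R.saleFlow t ω ∈ S.demandHull (R.Y t ω) := by
  filter_upwards [ae_all_iff.2 (R.saleMean_nonneg t), ae_all_iff.2 (R.saleMean_le t)]
    with ω h0 h1
  set y := R.Y t ω
  let g : ∀ k, Bool × S.prices k → ℝ × ℝ := fun k o =>
    ((ind o.1 : ℝ) * (((o.2 : ℝ) - S.α k) * S.demandFn k o.2 y),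
      (ind o.1 : ℝ) * S.demandFn k o.2 y)
  have hpi : Set.range (S.demandPoint y) = Set.univ.pi fun k => Set.range (g k) := by
    ext v
    constructor
    · rintro ⟨o, rfl⟩ k _
      exact ⟨(o.1 k, o.2 k), rfl⟩
    · intro hv
      choose o ho using fun k => hv k trivial
      exact ⟨(fun k => (o k).1, fun k => (o k).2), funext ho⟩
  rw [demandHull, hpi, convexHull_pi]
  intro k _
  have hmem : ∀ b, g k (b, R.P t ω k) ∈ convexHull ℝ (Set.range (g k)) := fun b =>
    subset_convexHull ℝ _ ⟨_, rfl⟩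
  set F := (ind (R.Z t ω k) : ℝ) * S.demandFn k (R.P t ω k) y with hF
  have hs0 := h0 k
  have hsF : R.saleMean t k ω ≤ F := h1 k
  -- If the mean demand `F` vanishes then `γ = 0` by the convention for division by zero, which
  -- is right because the mean sales vanish as well.
  set γ := R.saleMean t k ω / F with hγ
  have hγF : γ * F = R.saleMean t k ω := by
    rcases eq_or_ne F 0 with h | h
    · rw [h, mul_zero]; linarith
    · exact div_mul_cancel₀ _ h
  have hγ0 : 0 ≤ γ := div_nonneg hs0 (hs0.trans hsF)
  have hγ1 : γ ≤ 1 := div_le_one_of_le₀ hsF (hs0.trans hsF)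
  have hconv := convex_convexHull ℝ (Set.range (g k)) (hmem (R.Z t ω k)) (hmem false) hγ0
    (sub_nonneg.2 hγ1) (add_sub_cancel γ 1)
  convert hconv using 1
  ext
  · simp only [saleFlow, g, Prod.fst_add, Prod.smul_fst, smul_eq_mul]
    rw [← hγF, hF]
    simp only [show ind false = 0 from rfl, Nat.cast_zero, zero_mul, mul_zero, add_zero]
    ring
  · simp only [saleFlow, g, Prod.snd_add, Prod.smul_snd, smul_eq_mul]
    rw [← hγF, hF]
    simp only [show ind false = 0 from rfl, Nat.cast_zero, zero_mul, mul_zero, add_zero]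

theorem integrable_sold_mul_price (R : S.Run μ) (t : ℕ) (k : Fin K) :
    Integrable ((fun ω => (R.sold t ω k : ℝ)) * fun ω => (R.P t ω k : ℝ) - S.α k) μ := by
  obtain ⟨B, -, hB⟩ := S.exists_abs_price_sub_le
  exact (R.integrable_sold t k).mul_bdd
    ((R.stronglyMeasurable_price t k).mono (R.info.le t)).aestronglyMeasurable
    (ae_of_all _ fun ω => hB k (R.P t ω k))

theorem condExp_sold_mul_price (R : S.Run μ) (t : ℕ) (k : Fin K) :
    μ[(fun ω => (R.sold t ω k : ℝ)) * fun ω => (R.P t ω k : ℝ) - S.α k | R.info t]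
      =ᵐ[μ] fun ω => R.saleMean t k ω * ((R.P t ω k : ℝ) - S.α k) :=
  condExp_mul_of_stronglyMeasurable_right (R.stronglyMeasurable_price t k)
    (R.integrable_sold_mul_price t k) (R.integrable_sold t k)

theorem integrable_saleFlow_apply (R : S.Run μ) (t : ℕ) (k : Fin K) :
    Integrable (fun ω => R.saleFlow t ω k) μ :=
  (integrable_condExp.congr (R.condExp_sold_mul_price t k)).prodMk integrable_condExp

theorem integral_saleFlow_apply (R : S.Run μ) (t : ℕ) (k : Fin K) :
    (∫ ω, R.saleFlow t ω ∂μ) k =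
      (∫ ω, (R.sold t ω k : ℝ) * ((R.P t ω k : ℝ) - S.α k) ∂μ, ∫ ω, (R.sold t ω k : ℝ) ∂μ) := by
  have h := R.integrable_saleFlow_apply t k
  rw [eval_integral (R.integrable_saleFlow_apply t)]
  refine (integral_pair h.fst h.snd).trans (Prod.ext ?_ ?_)
  · exact (integral_congr_ae (R.condExp_sold_mul_price t k).symm).trans
      (integral_condExp (R.info.le t))
  · exact integral_condExp (R.info.le t)

variable [Countable 𝒳] [DiscreteMeasurableSpace 𝒳]

theorem integrable_supplyPoint (R : S.Run μ) (t : ℕ) :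
    Integrable (fun ω => S.supplyPoint (R.X t ω) (R.A t ω)) μ := by
  have hA : Measurable fun ω => R.A t ω := (R.measurable_A t).mono (R.info.le t) le_rfl
  have hX : Measurable fun ω => R.X t ω := (R.measurable_X t).mono (R.info.le t) le_rfl
  have hAm : ∀ m, Measurable fun ω => (R.A t ω m : ℝ) := fun m =>
    (measurable_from_top (f := fun n : ℕ => (n : ℝ))).comp ((measurable_pi_apply m).comp hA)
  have hp : ∀ m, Measurable fun ω => (S.unitPrice (R.X t ω) m : ℝ) := fun m =>
    (measurable_of_countable fun x => (S.unitPrice x m : ℝ)).comp hX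
  refine Integrable.of_bound (Measurable.aestronglyMeasurable ?_) _
    (ae_of_all _ fun ω => S.norm_supplyPoint_le (R.purchase_mem t ω))
  exact (Finset.measurable_fun_sum _ fun m _ => (hp m).mul (hAm m)).prodMk
    (measurable_pi_lambda _ hAm)

theorem integrable_actualProfit (R : S.Run μ) (t : ℕ) : Integrable (R.actualProfit t) μ := by
  rw [R.actualProfit_eq]
  exact (R.integrable_supplyPoint t).fst.neg.add
    (integrable_finsetSum _ fun k _ => R.integrable_sold_mul_price t k)

theorem flowProfit_meanFlow (R : S.Run μ) (t : ℕ) :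
    flowProfit (R.meanFlow t) = ∫ ω, R.actualProfit t ω ∂μ := by
  have h1 := (R.integrable_supplyPoint t).fst
  have h2 := R.integrable_sold_mul_price t
  rw [R.actualProfit_eq]
  refine Eq.trans ?_ (integral_add h1.neg (integrable_finsetSum _ fun k _ => h2 k)).symm
  rw [integral_finsetSum _ fun k _ => h2 k, flowProfit, meanFlow,
    fst_integral (R.integrable_supplyPoint t)]
  congr 1
  · exact (integral_neg _).symm
  · exact Finset.sum_congr rfl fun k _ => congrArg Prod.fst (R.integral_saleFlow_apply t k)

theorem integrable_purchase (R : S.Run μ) (t : ℕ) (m : Fin M) :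
    Integrable (fun ω => (R.A t ω m : ℝ)) μ :=
  (R.integrable_supplyPoint t).snd.eval m

theorem flowDeficit_meanFlow (R : S.Run μ) (t : ℕ) (m : Fin M) :
    S.flowDeficit m (R.meanFlow t) =
      ∫ ω, (∑ k, (S.β m k : ℝ) * (R.sold t ω k : ℝ) - (R.A t ω m : ℝ)) ∂μ := by
  have h1 : ∀ k, Integrable (fun ω => (S.β m k : ℝ) * (R.sold t ω k : ℝ)) μ := fun k =>
    (R.integrable_sold t k).const_mul _
  rw [integral_sub (integrable_finsetSum _ fun k _ => h1 k) (R.integrable_purchase t m),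
    integral_finsetSum _ fun k _ => h1 k, flowDeficit, meanFlow,
    snd_integral (R.integrable_supplyPoint t)]
  congr 1
  · exact Finset.sum_congr rfl fun k _ => by
      rw [integral_const_mul]
      exact congrArg (_ * Prod.snd ·) (R.integral_saleFlow_apply t k)
  · exact eval_integral (fun m => R.integrable_purchase t m) m

theorem sum_flowDeficit_le (R : S.Run μ)
    (hQ : ∀ m, Integrable (fun ω => (R.Q 0 ω m : ℝ)) μ) (m : Fin M) (t : ℕ) :
    ∑ τ ∈ Finset.range t, S.flowDeficit m (R.meanFlow τ) ≤ ∫ ω, (R.Q 0 ω m : ℝ) ∂μ := by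
  have hint : ∀ τ, Integrable
      (fun ω => ∑ k, (S.β m k : ℝ) * (R.sold τ ω k : ℝ) - (R.A τ ω m : ℝ)) μ := fun τ =>
    (integrable_finsetSum _ fun k _ => (R.integrable_sold τ k).const_mul _).sub
      (R.integrable_purchase τ m)
  simp only [R.flowDeficit_meanFlow]
  rw [← integral_finsetSum _ fun τ _ => hint τ]
  refine integral_mono (integrable_finsetSum _ fun τ _ => hint τ) (hQ m) fun ω => ?_
  have h := R.inventory_add_sum m ω t
  have h0 : (0 : ℝ) ≤ R.Q t ω m := by positivity
  dsimp only
  linarith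

theorem flowProfit_avgFlow (R : S.Run μ) (t : ℕ) : flowProfit (R.avgFlow t) =
    (1 / (t : ℝ)) * ∑ τ ∈ Finset.range t, ∫ ω, R.actualProfit τ ω ∂μ := by
  simp only [← R.flowProfit_meanFlow, avgFlow, flowProfit, Prod.smul_fst, Prod.smul_snd,
    Prod.fst_sum, Prod.snd_sum, Finset.sum_apply, Pi.smul_apply, smul_eq_mul,
    Finset.sum_add_distrib, Finset.sum_neg_distrib, ← Finset.mul_sum]
  rw [Finset.sum_comm]
  ring

variable [Countable 𝒴] [DiscreteMeasurableSpace 𝒴]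

/-- In each single slot, the plant has the same mean flow as some stationary randomized policy. -/
theorem meanFlow_mem (R : S.Run μ) (t : ℕ) : R.meanFlow t ∈ S.flowSet := by
  refine ⟨integral_mem_weightedSums (fun _ => convex_convexHull ℝ _)
    (fun x => (S.isCompact_supplyHull x).isClosed) S.supplyHull_nonempty
    ((R.measurable_X t).mono (R.info.le t) le_rfl) (R.law_X t) (R.integrable_supplyPoint t)
    (ae_of_all _ fun ω => subset_convexHull ℝ _ ⟨_, R.purchase_mem t ω, rfl⟩),
    integral_mem_weightedSums (fun _ => convex_convexHull ℝ _)
    (fun y => (S.isCompact_demandHull y).isClosed) S.demandHull_nonempty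
    ((R.measurable_Y t).mono (R.info.le t) le_rfl) (R.law_Y t)
    (Integrable.of_eval (R.integrable_saleFlow_apply t)) (R.saleFlow_mem t)⟩

theorem avgFlow_mem (R : S.Run μ) {t : ℕ} (ht : t ≠ 0) : R.avgFlow t ∈ S.flowSet := by
  rw [avgFlow, Finset.smul_sum]
  refine S.convex_flowSet.sum_mem (fun _ _ => by positivity) ?_ fun τ _ => R.meanFlow_mem τ
  simp [ht]

end Run

end Plant

end

/-! ### The bound on the time averages -/

theorem theorem1 {M K : ℕ} {𝒳 𝒴 : Type*}
    [Countable 𝒳] [MeasurableSpace 𝒳] [DiscreteMeasurableSpace 𝒳]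
    [Countable 𝒴] [MeasurableSpace 𝒴] [DiscreteMeasurableSpace 𝒴]
    (S : Plant M K 𝒳 𝒴)
    {Ω : Type*} [MeasurableSpace Ω] (μ : Measure Ω) [IsProbabilityMeasure μ]
    (R : S.Run μ)
    (hQ : ∀ m, Integrable (fun ω => (R.Q 0 ω m : ℝ)) μ) :
    IsGreatest S.feasibleProfits S.optProfit ∧
    (∀ τ, Integrable (R.actualProfit τ) μ) ∧
    limsup (fun t : ℕ =>
        (((1 / (t : ℝ)) * ∑ τ ∈ Finset.range t, ∫ ω, R.actualProfit τ ω ∂μ : ℝ) : EReal)) atTop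
      ≤ (S.optProfit : EReal) := by
  refine ⟨S.isGreatest_optProfit, R.integrable_actualProfit, ?_⟩
  simp only [← R.flowProfit_avgFlow]
  by_contra! hlt
  obtain ⟨b, hb1, hb2⟩ := EReal.lt_iff_exists_real_btwn.1 hlt
  have hfreq := (frequently_lt_of_lt_limsup (by isBoundedDefault) hb2).and_eventually
    (eventually_ne_atTop 0)
  -- Along a subsequence the averages stay above `b` and converge to a flow `q`, in which the
  -- deficit of material that the initial inventory allows has vanished.
  have hK : IsCompact (S.flowSet ∩ {q | b ≤ Plant.flowProfit q}) :=
    S.isCompact_flowSet.inter_right (isClosed_le continuous_const Plant.continuous_flowProfit)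
  obtain ⟨q, ⟨hq, hqb⟩, φ, hφ, hlim⟩ := hK.tendsto_subseq' (x := R.avgFlow)
    (hfreq.mono fun t ht => ⟨R.avgFlow_mem ht.2, (EReal.coe_lt_coe_iff.1 ht.1).le⟩)
  have hdef : ∀ m, S.flowDeficit m q ≤ 0 := fun m => by
    have h1 := ((S.continuous_flowDeficit m).tendsto q).comp hlim
    have h2 : Tendsto (fun n => (1 / (φ n : ℝ)) * ∫ ω, (R.Q 0 ω m : ℝ) ∂μ) atTop (nhds 0) := by
      simpa using (tendsto_one_div_atTop_nhds_zero_nat.comp hφ.tendsto_atTop).mul_const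
        (∫ ω, (R.Q 0 ω m : ℝ) ∂μ)
    refine le_of_tendsto_of_tendsto' h1 h2 fun n => ?_
    simp only [Function.comp_apply, R.flowDeficit_avgFlow]
    exact mul_le_mul_of_nonneg_left (R.sum_flowDeficit_le hQ m _) (by positivity)
  have hle : Plant.flowProfit q ≤ S.optProfit :=
    S.isGreatest_optProfit.2 (by rw [S.feasibleProfits_eq]; exact ⟨q, ⟨hq, hdef⟩, rfl⟩)
  exact absurd (EReal.coe_lt_coe_iff.1 hb1) (not_lt.2 (le_trans hqb hle))
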